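/- **Setting.** Fix integers $d\ge 1$, $T\ge 0$ and closed sets $K_t^j\subseteq\mathbb R$ ($0\le t\le T$, $1\le j\le d$). Put $\Omega_{0:t}=\prod_{s=0}^{t}\prod_{j=1}^{d}K_s^j$, $\Omega=\Omega_{0:T}$, and $$\|\phi\|_{0:t}=\sup_{x\in\Omega_{0:t}}\frac{|\phi(x)|}{1+\sum_{s=0}^{t}\sum_{j=1}^d|x_s^j|}.$$ Let $C_{0:t}$ be the space of continuous $\phi:\Omega_{0:t}\to\mathbb R$ with $\|\phi\|_{0:t}<\infty$, and $B_{0:T}$ the space of Borel measurable $\phi:\Omega\to\mathbb R$ with $\|\phi\|_{0:T}<\infty$. Let $\mathrm{Prob}^1(\Omega)$ be the set of Borel probability measures $Q$ on $\Omega$ for which all elements of $C_{0:T}$ are integrable; each such $Q$ is identified with the functional $\phi\mapsto\int\phi\,dQ$ on $C_{0:T}$. Let $\mathcal E_t$ be vector subspaces with $\mathbb R\subseteq\mathcal E_t\subseteq C_{0:t}$, and $\mathcal E=\mathcal E_0\times\dots\times\mathcal E_T$. Let $U:\mathcal E\to[-\infty,+\infty)$ be concave with $U(0)\in\mathbb R$,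 and put $V(\varphi)=-U(-\varphi)$. Let $\mathcal A\subseteq C_{0:T}$ be a convex cone with $0\in\mathcal A$; thus $\mathrm{Prob}^1(\Omega)\cap\mathcal A^\circ$ is the set of $Q\in\mathrm{Prob}^1(\Omega)$ with $\int z\,dQ\le 0$ for all $z\in\mathcal A$. Assume that there are, for $n\ge1$ and $0\le t\le T$, compact sets $\mathfrak K_t(n)\subseteq\prod_{j}K_t^j$ and functions $0\le f_t^n\in\mathcal E_t$ such that $$1+\sum_{t=0}^T\sum_{j=1}^d|x_t^j|\le\sum_{t=0}^Tf_t^n(x_0,\dots,x_t)\qquad\text{for all }x\in\Omega\setminus\big(\mathfrak K_0(n)\times\dots\times\mathfrak K_T(n)\big),$$ and $V(\Gamma f_0^n,\dots,\Gamma f_T^n)\to0$ as $n\to\infty$ for every real $\Gamma>0$. For $\varphi\in\mathcal E$ let $S^U(\varphi)=\sup_{\beta\in\mathbb R^{T+1}}\big(U(\varphi+\beta)-\sum_{t=0}^T\beta_t\big)$. For $c:\Omega\to(-\infty,+\infty]$ and $z\in C_{0:T}$ let $$\Phi_z(c)=\Big\{\varphi\in\mathcal E:\ S^U(\varphi)>-\infty,\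 \sum_{t=0}^T\varphi_t(x_0,\dots,x_t)+z(x)\le c(x)\ \ \forall x\in\Omega\Big\},\qquad \mathfrak P(c)=\sup_{z\in-\mathcal A}\ \sup_{\varphi\in\Phi_z(c)}S^U(\varphi),$$ with $\sup\emptyset=-\infty$. For $Q\in\mathrm{Prob}^1(\Omega)$, with $Q_t$ the marginal of $Q$ on $\Omega_{0:t}$, let $$\mathcal D(Q)=\sup_{\varphi\in\mathcal E}\Big(U(\varphi)-\sum_{t=0}^T\int_{\Omega_{0:t}}\varphi_t\,dQ_t\Big).$$ **Theorem.** (i) If $\mathfrak P(\widehat c)<+\infty$ for some $\widehat c\in B_{0:T}$, then $\mathfrak P(c)\in\mathbb R$ for every $c\in B_{0:T}$, and $\mathfrak P:B_{0:T}\to\mathbb R$ is continuous for $\|\cdot\|_{0:T}$, cash additive (that is, $\mathfrak P(c+\beta)=\mathfrak P(c)+\beta$ for $\beta\in\mathbb R$), concave and nondecreasing. (ii) For every $Q\in\mathrm{Prob}^1(\Omega)$ one also has $\mathcal D(Q)=\sup_{\varphi\in\mathcal E}\big(\sum_{t=0}^T\int_{\Omega_{0:t}}\varphi_t\,dQ_t-V(\varphi)\big)$.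 For every lower semicontinuous $c:\Omega\to(-\infty,+\infty]$ for which there is $a\in[0,+\infty)$ with $c(x)\ge-a\big(1+\sum_{t=0}^T\sum_{j=1}^d|x_t^j|\big)$ for all $x\in\Omega$, $$\mathfrak P(c)=\inf_{Q\in\mathrm{Prob}^1(\Omega)\cap\mathcal A^\circ}\big(E_Q[c]+\mathcal D(Q)\big)$$ (with $\inf\emptyset=+\infty$), and if $\mathfrak P(c)<+\infty$ the infimum is attained. -/

import Mathlib

open MeasureTheory Filter Topology

noncomputable section

namespace EMOT

/-! ### Path spaces and weighted function spaces -/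

/-- The product `∏ᵢ ∏ⱼ Kᵢʲ`, where `i` runs over a set of times and `j = 1, …, d` over the stocks.
It carries the product topology and the product (which is the Borel) σ-algebra. -/
abbrev PathSpace {ι : Type} {d : ℕ} (K : ι → Fin d → Set ℝ) : Type :=
  ∀ (i : ι) (j : Fin d), K i j

/-- The weight `1 + ∑ᵢ ∑ⱼ |xᵢʲ|`. -/
def weight {ι : Type} [Fintype ι] {d : ℕ} {K : ι → Fin d → Set ℝ} (x : PathSpace K) : ℝ :=
  1 + ∑ i, ∑ j, |(x i j : ℝ)|

/-- The weighted sup norm `sup_x |φ(x)| / (1 + ∑ᵢ ∑ⱼ |xᵢʲ|)`. -/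
def wNorm {ι : Type} [Fintype ι] {d : ℕ} {K : ι → Fin d → Set ℝ} (φ : PathSpace K → ℝ) : ℝ :=
  ⨆ x, |φ x| / weight x

/-- The real functions on the path space with finite weighted sup norm. -/
def boundedSpace {ι : Type} [Fintype ι] {d : ℕ} (K : ι → Fin d → Set ℝ) :
    Submodule ℝ (PathSpace K → ℝ) where
  carrier := {φ | ∃ M : ℝ, ∀ x, |φ x| ≤ M * weight x}
  add_mem' := by
    rintro φ ψ ⟨M, hM⟩ ⟨N, hN⟩
    refine ⟨M + N, fun x => ?_⟩
    rw [add_mul]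
    exact (abs_add_le _ _).trans (add_le_add (hM x) (hN x))
  zero_mem' := ⟨0, fun x => by simp⟩
  smul_mem' := by
    rintro r φ ⟨M, hM⟩
    refine ⟨|r| * M, fun x => ?_⟩
    rw [Pi.smul_apply, smul_eq_mul, abs_mul, mul_assoc]
    exact mul_le_mul_of_nonneg_left (hM x) (abs_nonneg r)

/-- Continuous functions with finite weighted sup norm. -/
def CSpace {ι : Type} [Fintype ι] {d : ℕ} (K : ι → Fin d → Set ℝ) :
    Submodule ℝ (PathSpace K → ℝ) where
  carrier := {φ | Continuous φ ∧ φ ∈ boundedSpace K}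
  add_mem' := fun ha hb => ⟨ha.1.add hb.1, (boundedSpace K).add_mem ha.2 hb.2⟩
  zero_mem' := ⟨continuous_zero, (boundedSpace K).zero_mem⟩
  smul_mem' := fun r _ ha => ⟨ha.1.const_smul r, (boundedSpace K).smul_mem r ha.2⟩

/-- Borel measurable functions with finite weighted sup norm. -/
def BSpace {ι : Type} [Fintype ι] {d : ℕ} (K : ι → Fin d → Set ℝ) :
    Submodule ℝ (PathSpace K → ℝ) where
  carrier := {φ | Measurable φ ∧ φ ∈ boundedSpace K}
  add_mem' := fun ha hb => ⟨ha.1.add hb.1, (boundedSpace K).add_mem ha.2 hb.2⟩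
  zero_mem' := ⟨measurable_zero, (boundedSpace K).zero_mem⟩
  smul_mem' := fun r _ ha => ⟨ha.1.const_smul r, (boundedSpace K).smul_mem r ha.2⟩

lemma one_le_weight {ι : Type} [Fintype ι] {d : ℕ} {K : ι → Fin d → Set ℝ}
    (x : PathSpace K) : 1 ≤ weight x :=
  le_add_of_nonneg_right
    (Finset.sum_nonneg fun _ _ => Finset.sum_nonneg fun _ _ => abs_nonneg _)

lemma const_mem_boundedSpace {ι : Type} [Fintype ι] {d : ℕ} (K : ι → Fin d → Set ℝ) (r : ℝ) :
    (fun _ => r) ∈ boundedSpace K :=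
  ⟨|r|, fun x => le_mul_of_one_le_right (abs_nonneg r) (one_le_weight x)⟩

/-- The constant `r` as an element of the space of weighted continuous functions. -/
def constC {ι : Type} [Fintype ι] {d : ℕ} (K : ι → Fin d → Set ℝ) (r : ℝ) : CSpace K :=
  ⟨fun _ => r, continuous_const, const_mem_boundedSpace K r⟩

/-- The constant `r` as an element of the space of weighted Borel functions. -/
def constB {ι : Type} [Fintype ι] {d : ℕ} (K : ι → Fin d → Set ℝ) (r : ℝ) : BSpace K :=
  ⟨fun _ => r, measurable_const, const_mem_boundedSpace K r⟩

/-! ### Histories and hedging instruments -/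

/-- The family `(Kₛʲ)` restricted to times `s ≤ t`; its path space is `Ω_{0:t}`. -/
abbrev upTo {d T : ℕ} (K : Fin (T + 1) → Fin d → Set ℝ) (t : Fin (T + 1)) :
    Set.Iic t → Fin d → Set ℝ :=
  fun s => K s

/-- The projection `x ↦ (x₀, …, x_t)` from `Ω` to `Ω_{0:t}`. -/
def hist {d T : ℕ} {K : Fin (T + 1) → Fin d → Set ℝ} (t : Fin (T + 1)) (x : PathSpace K) :
    PathSpace (upTo K t) :=
  fun s => x s

/-- The product `ℰ = ℰ₀ × ⋯ × ℰ_T`, where `ℰ_t` is a vector subspace of `C_{0:t}`. -/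
abbrev Hedge {d T : ℕ} {K : Fin (T + 1) → Fin d → Set ℝ}
    (E : ∀ t, Submodule ℝ (CSpace (upTo K t))) : Type :=
  ∀ t, E t

/-- The value `φ_t(x₀, …, x_t)` of a hedging instrument along a full path `x`. -/
def Hedge.eval {d T : ℕ} {K : Fin (T + 1) → Fin d → Set ℝ}
    {E : ∀ t, Submodule ℝ (CSpace (upTo K t))} (φ : Hedge E) (t : Fin (T + 1))
    (x : PathSpace K) : ℝ :=
  (φ t : CSpace (upTo K t)).1 (hist t x)

/-- All real constants belong to every `ℰ_t`. -/
def HasConstants {d T : ℕ} {K : Fin (T + 1) → Fin d → Set ℝ}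
    (E : ∀ t, Submodule ℝ (CSpace (upTo K t))) : Prop :=
  ∀ t (r : ℝ), constC (upTo K t) r ∈ E t

/-- A vector `β ∈ ℝ^{T+1}` as an element of `ℰ`. -/
def constHedge {d T : ℕ} {K : Fin (T + 1) → Fin d → Set ℝ}
    {E : ∀ t, Submodule ℝ (CSpace (upTo K t))} (hE : HasConstants E)
    (β : Fin (T + 1) → ℝ) : Hedge E :=
  fun t => ⟨constC (upTo K t) (β t), hE t (β t)⟩

/-! ### The valuation functional and the functionals built from it -/

/-- `U : X → [-∞, +∞)` is concave. -/
def IsConcave {X : Type} [AddCommGroup X] [Module ℝ X] (U : X → EReal) : Prop :=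
  ∀ (φ ψ : X) (a b : ℝ), 0 ≤ a → 0 ≤ b → a + b = 1 →
    (a : EReal) * U φ + (b : EReal) * U ψ ≤ U (a • φ + b • ψ)

/-- `V(φ) = -U(-φ)`. -/
def V {X : Type} [AddCommGroup X] (U : X → EReal) (φ : X) : EReal := -U (-φ)

/-- The generalized optimized certainty equivalent
`S^U(φ) = sup_β (U(φ + β) - ∑ₜ βₜ)`. -/
def SU {d T : ℕ} {K : Fin (T + 1) → Fin d → Set ℝ}
    {E : ∀ t, Submodule ℝ (CSpace (upTo K t))} (hE : HasConstants E)
    (U : Hedge E → EReal) (φ : Hedge E) : EReal :=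
  ⨆ β : Fin (T + 1) → ℝ, U (φ + constHedge hE β) - ((∑ t, β t : ℝ) : EReal)

/-- The set `Φ_z(c)` of `φ ∈ dom(S^U)` with `∑ₜ φₜ(x₀, …, xₜ) + z(x) ≤ c(x)` for all `x ∈ Ω`. -/
def Phi {d T : ℕ} {K : Fin (T + 1) → Fin d → Set ℝ}
    {E : ∀ t, Submodule ℝ (CSpace (upTo K t))} (hE : HasConstants E)
    (U : Hedge E → EReal) (z : CSpace K) (c : PathSpace K → EReal) : Set (Hedge E) :=
  {φ | ⊥ < SU hE U φ ∧ ∀ x, ((∑ t, φ.eval t x + z.1 x : ℝ) : EReal) ≤ c x}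

/-- The nonlinear subhedging functional
`𝔓(c) = sup_{z ∈ -A} sup_{φ ∈ Φ_z(c)} S^U(φ)`, with `sup ∅ = -∞`. -/
def P {d T : ℕ} {K : Fin (T + 1) → Fin d → Set ℝ}
    {E : ∀ t, Submodule ℝ (CSpace (upTo K t))} (hE : HasConstants E)
    (U : Hedge E → EReal) (A : ConvexCone ℝ (CSpace K)) (c : PathSpace K → EReal) : EReal :=
  ⨆ (z : CSpace K) (_ : -z ∈ A) (φ : Hedge E) (_ : φ ∈ Phi hE U z c), SU hE U φ

/-- There are compact sets `𝔎_t(n)` and instruments `0 ≤ f_t^n ∈ ℰ_t` such that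
`1 + ∑ |x_t^j| ≤ ∑ₜ f_t^n(x₀, …, xₜ)` off `𝔎₀(n) × ⋯ × 𝔎_T(n)`,
and `V(Γ f₀ⁿ, …, Γ f_Tⁿ) → 0` for every `Γ > 0`. -/
def CallsVanish {d T : ℕ} {K : Fin (T + 1) → Fin d → Set ℝ}
    {E : ∀ t, Submodule ℝ (CSpace (upTo K t))} (U : Hedge E → EReal) : Prop :=
  ∃ (C : ∀ t : Fin (T + 1), ℕ → Set (∀ j : Fin d, K t j)) (f : ℕ → Hedge E),
    (∀ t n, IsCompact (C t n)) ∧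
    (∀ n t (y : PathSpace (upTo K t)), 0 ≤ (f n t : CSpace (upTo K t)).1 y) ∧
    (∀ n (x : PathSpace K), ¬ (∀ t, x t ∈ C t n) → weight x ≤ ∑ t, (f n).eval t x) ∧
    (∀ Γ : ℝ, 0 < Γ → Tendsto (fun n => V U (Γ • f n)) atTop (𝓝 0))

/-! ### The dual side -/

/-- Borel probability measures on `Ω` that integrate every element of `C_{0:T}`. -/
def Prob1 {d T : ℕ} (K : Fin (T + 1) → Fin d → Set ℝ) : Set (Measure (PathSpace K)) :=
  {Q | IsProbabilityMeasure Q ∧ ∀ φ ∈ CSpace K, Integrable φ Q}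

/-- The measures in `Prob¹(Ω)` whose induced functional `c ↦ ∫ c dQ` on `C_{0:T}` lies in the
polar `A° = {λ | ⟨z, λ⟩ ≤ 0 for all z ∈ A}`. -/
def Prob1Polar {d T : ℕ} {K : Fin (T + 1) → Fin d → Set ℝ} (A : ConvexCone ℝ (CSpace K)) :
    Set (Measure (PathSpace K)) :=
  {Q | Q ∈ Prob1 K ∧ ∀ z ∈ A, ∫ x, z.1 x ∂Q ≤ 0}

/-- The expectation `E_Q[c] = E_Q[c⁺] - E_Q[c⁻]` of an extended real function. -/
def expect {X : Type} [MeasurableSpace X] (Q : Measure X) (c : X → EReal) : EReal :=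
  ((∫⁻ x, (c x).toENNReal ∂Q : ENNReal) : EReal) -
    ((∫⁻ x, (-c x).toENNReal ∂Q : ENNReal) : EReal)

/-- The pairing `∑ₜ ∫_{Ω_{0:t}} φₜ dQₜ`, where `Qₜ` is the marginal of `Q` on `Ω_{0:t}`. -/
def pairing {d T : ℕ} {K : Fin (T + 1) → Fin d → Set ℝ}
    {E : ∀ t, Submodule ℝ (CSpace (upTo K t))} (φ : Hedge E) (Q : Measure (PathSpace K)) : ℝ :=
  ∑ t, ∫ y, (φ t : CSpace (upTo K t)).1 y ∂(Q.map (hist t))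

/-- The penalty `𝒟(Q) = sup_{φ ∈ ℰ} (U(φ) - ∑ₜ ∫ φₜ dQₜ)`. -/
def D {d T : ℕ} {K : Fin (T + 1) → Fin d → Set ℝ}
    {E : ∀ t, Submodule ℝ (CSpace (upTo K t))} (U : Hedge E → EReal)
    (Q : Measure (PathSpace K)) : EReal :=
  ⨆ φ : Hedge E, U φ - (pairing φ Q : EReal)

end EMOT

end

noncomputable section

namespace EMOT

/-! ### Supporting functionals of convex functions -/

/-! Moving the cash vector `β` of $S^U$ into the hedge shows that $\mathfrak P(c)$ is the supremum
of the reals `r` for which some `z ∈ -A`, `φ ∈ ℰ` and cash `s` satisfy `φ + z - s ≤ c` and `r + s ≤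
U φ`. In this form concavity, monotonicity and cash additivity are operations on triples `(z, φ,
s)`. Short positions in the vanishing calls subhedge every payoff of linear growth, so `𝔓 > -∞`; by
concavity, finiteness at one perturbation of a payoff spreads to all of them.

Weak duality is integration of `φ + z - s ≤ c`. For the converse, fix `c` and consider `p(u) = 𝔓(c +
u)` on all functions `u` of linear growth. Being finite and concave, `p` has an algebraic supporting
functional `l` at `0`, with `p u ≤ p 0 + l u`. Monotonicity and cash additivity make `l` positive
with `l 1 = 1`, and the vanishing calls make it tight, so on `C_{0:T}` it is integration against a
probability `Q`. If `g ≤ c` is in `C_{0:T}`, then `c + (φ + z - g) ≥ φ + z`, hence `U φ ≤ 𝔓(c) + l(φ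
+ z - g)`. Scaling `z` in the cone puts `Q` in the polar; `z = 0` and the supremum over `φ` give `∫
g dQ + 𝒟(Q) ≤ 𝔓(c)`. Letting `g` increase to `c` replaces `∫ g dQ` by `E_Q[c]`. The same `Q` serves
every `g`, so it attains the infimum. -/

/-- The one-sided directional derivative at the origin, as an infimum of difference quotients. -/
def dirDeriv {X : Type*} [AddCommGroup X] [Module ℝ X] (G : X → ℝ) (u : X) : ℝ :=
  ⨅ s : Set.Ioi (0 : ℝ), (G ((s : ℝ) • u) - G 0) / s

section DirDeriv

variable {X : Type*} [AddCommGroup X] [Module ℝ X] {G : X → ℝ}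

/-- The origin lies on the segment from `-u` to `s • u`. The bound does not depend on `s`, so the
infimum in `dirDeriv` is a genuine one. -/
lemma neg_le_diffQuot (hG : ConvexOn ℝ Set.univ G) (u : X) {s : ℝ} (hs : 0 < s) :
    -(G (-u) - G 0) ≤ (G (s • u) - G 0) / s := by
  have h := hG.2 (Set.mem_univ (s • u)) (Set.mem_univ (-u)) (by positivity : 0 ≤ 1 / (1 + s))
    (by positivity : 0 ≤ s / (1 + s)) (by field_simp)
  have h0 : (1 / (1 + s)) • s • u + (s / (1 + s)) • -u = 0 := by
    rw [smul_smul, smul_neg, ← sub_eq_add_neg, ← sub_smul]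
    convert zero_smul ℝ u using 2
    field_simp
    ring
  rw [h0, smul_eq_mul, smul_eq_mul] at h
  rw [le_div_iff₀ hs]
  have h2 : (1 + s) * G 0 ≤ G (s • u) + s * G (-u) := by
    calc (1 + s) * G 0 ≤ (1 + s) * (1 / (1 + s) * G (s • u) + s / (1 + s) * G (-u)) := by gcongr
      _ = _ := by field_simp
  linarith

lemma dirDeriv_le (hG : ConvexOn ℝ Set.univ G) (u : X) {s : ℝ} (hs : 0 < s) :
    dirDeriv G u ≤ (G (s • u) - G 0) / s :=
  ciInf_le (f := fun s : Set.Ioi (0 : ℝ) => (G ((s : ℝ) • u) - G 0) / s)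
    ⟨-(G (-u) - G 0), by rintro _ ⟨t, rfl⟩; exact neg_le_diffQuot hG u t.2⟩ ⟨s, hs⟩

lemma le_dirDeriv {u : X} {r : ℝ} (h : ∀ s : ℝ, 0 < s → r ≤ (G (s • u) - G 0) / s) :
    r ≤ dirDeriv G u :=
  le_ciInf fun s => h s s.2

lemma dirDeriv_smul_le (hG : ConvexOn ℝ Set.univ G) {a : ℝ} (ha : 0 < a) (u : X) :
    dirDeriv G (a • u) ≤ a * dirDeriv G u := by
  rw [mul_comm, ← div_le_iff₀ ha]
  refine le_dirDeriv fun s hs => ?_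
  rw [div_le_iff₀ ha]
  refine (dirDeriv_le hG (a • u) (div_pos hs ha)).trans_eq ?_
  rw [smul_smul, div_mul_cancel₀ _ ha.ne']
  field_simp

lemma dirDeriv_smul (hG : ConvexOn ℝ Set.univ G) {a : ℝ} (ha : 0 < a) (u : X) :
    dirDeriv G (a • u) = a * dirDeriv G u := by
  refine le_antisymm (dirDeriv_smul_le hG ha u) ?_
  have h := dirDeriv_smul_le hG (inv_pos.2 ha) (a • u)
  rw [smul_smul, inv_mul_cancel₀ ha.ne', one_smul] at h
  calc a * dirDeriv G u ≤ a * (a⁻¹ * dirDeriv G (a • u)) := by gcongr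
    _ = _ := by field_simp

/-- For steps `s` along `u` and `t` along `v`, the step `s * t / (s + t)` along `u + v` lands on a
convex combination of `s • u` and `t • v`. -/
lemma dirDeriv_add (hG : ConvexOn ℝ Set.univ G) (u v : X) :
    dirDeriv G (u + v) ≤ dirDeriv G u + dirDeriv G v := by
  rw [← sub_le_iff_le_add]
  refine le_dirDeriv fun s hs => ?_
  rw [sub_le_comm]
  refine le_dirDeriv fun t ht => ?_
  rw [sub_le_iff_le_add]
  have hst : 0 < s * t / (s + t) := by positivity
  refine (dirDeriv_le hG (u + v) hst).trans ?_
  have h := hG.2 (Set.mem_univ (s • u)) (Set.mem_univ (t • v)) (by positivity : 0 ≤ t / (s + t))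
    (by positivity : 0 ≤ s / (s + t)) (by field_simp; ring)
  have h0 : (t / (s + t)) • s • u + (s / (s + t)) • t • v = (s * t / (s + t)) • (u + v) := by
    rw [smul_smul, smul_smul, smul_add]
    congr 2 <;> ring
  rw [h0, smul_eq_mul, smul_eq_mul] at h
  rw [div_le_iff₀ hst]
  have h3 : ((G (t • v) - G 0) / t + (G (s • u) - G 0) / s) * (s * t / (s + t))
      = t / (s + t) * G (s • u) + s / (s + t) * G (t • v) - G 0 := by
    field_simp
    ring
  rw [h3]
  linarith

end DirDeriv

/-- Hahn–Banach under the sublinear `dirDeriv G`, starting from the zero subspace. As `G` is finite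
everywhere, no topology is involved. -/
theorem exists_linear_add_le_of_convexOn {X : Type*} [AddCommGroup X] [Module ℝ X] {G : X → ℝ}
    (hG : ConvexOn ℝ Set.univ G) : ∃ l : X →ₗ[ℝ] ℝ, ∀ u, G 0 + l u ≤ G u := by
  obtain ⟨l, -, hl⟩ := exists_extension_of_le_sublinear (⊥ : X →ₗ.[ℝ] ℝ) (dirDeriv G)
    (fun a ha u => dirDeriv_smul hG ha u) (dirDeriv_add hG) (by
      rintro ⟨u, hu⟩
      obtain rfl : u = 0 := (Submodule.mem_bot ℝ).1 hu
      have : (⊥ : X →ₗ.[ℝ] ℝ) ⟨0, hu⟩ = 0 := LinearPMap.map_zero _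
      rw [this]
      exact le_dirDeriv fun s hs => by simp)
  refine ⟨l, fun u => ?_⟩
  have := (hl u).trans (dirDeriv_le hG u one_pos)
  rw [one_smul, div_one] at this
  linarith

/-! ### Lower semicontinuous functions as monotone limits of continuous functions -/

/-- Inf-convolution of `min h k` with `k * edist` is `k`-Lipschitz. The cap at `k` keeps the
approximants finite, so that they can serve as real test functions. -/
theorem exists_continuous_monotone_iSup_eq {X : Type*} [PseudoEMetricSpace X]
    {h : X → ENNReal} (hh : LowerSemicontinuous h) :
    ∃ g : ℕ → X → ENNReal, Monotone g ∧ (∀ k, Continuous (g k)) ∧ (∀ k x, g k x ≤ k) ∧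
      ∀ x, ⨆ k, g k x = h x := by
  have hle : ∀ (k : ℕ) (x : X),
      ⨅ y, (min (h y) k + k * edist x y) ≤ min (h x) k := fun k x =>
    (iInf_le _ x).trans (by simp)
  refine ⟨fun k x => ⨅ y, (min (h y) k + k * edist x y), ?_, ?_, ?_, ?_⟩
  · intro k l hkl x
    exact iInf_mono fun y => by gcongr
  · intro k
    refine continuous_of_le_add_edist k (ENNReal.natCast_ne_top k) fun x y => ?_
    rw [ENNReal.iInf_add]
    refine le_iInf fun z => (iInf_le _ z).trans ?_
    rw [add_assoc, ← mul_add, add_comm (edist y z)]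
    gcongr
    exact edist_triangle _ _ _
  · exact fun k x => (hle k x).trans (min_le_right _ _)
  · intro x
    refine le_antisymm (iSup_le fun k => (hle k x).trans (min_le_left _ _)) ?_
    refine le_of_forall_lt fun r hr => ?_
    obtain ⟨q, hrq, hq⟩ := exists_between hr
    obtain ⟨δ, hδ, hball⟩ := EMetric.mem_nhds_iff.1 (hh x q hq)
    have hqt : q ≠ ⊤ := hq.ne_top
    -- With `k > q` the cap is harmless inside the ball; with `k > q / δ` the penalty alone reaches
    -- `q` outside it.
    obtain ⟨k, hk⟩ := ENNReal.exists_nat_gt (r := max q (q / δ))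
      (max_lt hqt.lt_top (ENNReal.div_lt_top hqt hδ.ne')).ne
    refine hrq.trans_le (le_iSup_of_le k (le_iInf fun y => ?_))
    by_cases hy : y ∈ Metric.eball x δ
    · exact le_add_right (le_min (hball hy).le ((le_max_left _ _).trans hk.le))
    · have h1 : δ ≤ edist x y := by
        rw [edist_comm]
        exact not_lt.1 hy
      refine le_add_left ?_
      have h2 : q / δ ≤ k := (le_max_right _ _).trans hk.le
      calc q ≤ k * δ := by
            rcases eq_or_ne δ ⊤ with rfl | hδt
            · exact le_top.trans_eq (ENNReal.mul_top (by rintro h; simp [h] at hk)).symm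
            · rwa [ENNReal.div_le_iff hδ.ne' hδt] at h2
        _ ≤ _ := by gcongr

/-! ### The expectation of extended real functions -/

section Expect

variable {X : Type} [MeasurableSpace X] {Q : Measure X}

lemma integral_le_expect {g : X → ℝ} {c : X → EReal} (hg : Integrable g Q)
    (hgc : ∀ x, (g x : EReal) ≤ c x) : ((∫ x, g x ∂Q : ℝ) : EReal) ≤ expect Q c := by
  have hp : ∫⁻ x, ENNReal.ofReal (g x) ∂Q ≠ ⊤ := hg.lintegral_lt_top.ne
  have hn : ∫⁻ x, ENNReal.ofReal (-g x) ∂Q ≠ ⊤ := hg.neg.lintegral_lt_top.ne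
  rw [integral_eq_lintegral_pos_part_sub_lintegral_neg_part hg, EReal.coe_sub, expect,
    EReal.coe_ennreal_toReal hp, EReal.coe_ennreal_toReal hn]
  refine EReal.sub_le_sub ?_ ?_
  · refine EReal.coe_ennreal_le_coe_ennreal_iff.2 (lintegral_mono fun x => ?_)
    exact EReal.toENNReal_le_toENNReal (hgc x)
  · refine EReal.coe_ennreal_le_coe_ennreal_iff.2 (lintegral_mono fun x => ?_)
    exact EReal.toENNReal_le_toENNReal (EReal.neg_le_neg_iff.2 (hgc x))

/-- Free of subtraction, hence integrable term by term in `ENNReal`, including where `c = ⊤`. -/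
lemma toENNReal_add_ofReal {c : EReal} {r : ℝ} (hr : 0 ≤ r) (hc : ((-r : ℝ) : EReal) ≤ c) :
    c.toENNReal + ENNReal.ofReal r = (c + (r : ℝ)).toENNReal + (-c).toENNReal := by
  induction c with
  | bot => simp at hc
  | top => simp
  | coe c =>
    rw [EReal.coe_le_coe_iff] at hc
    rw [← EReal.coe_add, ← EReal.coe_neg, EReal.real_coe_toENNReal, EReal.real_coe_toENNReal,
      EReal.real_coe_toENNReal]
    rcases le_total 0 c with h | h
    · rw [ENNReal.ofReal_of_nonpos (neg_nonpos.2 h), add_zero, ENNReal.ofReal_add h hr]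
    · rw [ENNReal.ofReal_of_nonpos h, zero_add,
        ← ENNReal.ofReal_add (by linarith) (neg_nonneg.2 h)]
      congr 1
      ring

/-- Monotone convergence applies to `c + a * w ≥ 0`; the finite integral of `a * w` is then removed.
It also bounds the negative part of `c`, so the difference in `expect` is between finite numbers. -/
lemma expect_le {c : X → EReal} {w : X → ℝ} {g : ℕ → X → ENNReal} {a m : ℝ}
    (ha : 0 ≤ a) (hw : Integrable w Q) (hw0 : ∀ x, 0 ≤ w x) (hc : Measurable c)
    (hac : ∀ x, ((-a * w x : ℝ) : EReal) ≤ c x)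
    (hg : Monotone g) (hgm : ∀ k, Measurable (g k)) (hgt : ∀ k x, g k x ≠ ⊤)
    (hgi : ∀ k, Integrable (fun x => (g k x).toReal) Q)
    (hgc : ∀ x, ⨆ k, g k x = (c x + (a * w x : ℝ)).toENNReal)
    (hm : ∀ k, ∫ x, ((g k x).toReal - a * w x) ∂Q ≤ m) : expect Q c ≤ m := by
  have haw : ∀ x, 0 ≤ a * w x := fun x => mul_nonneg ha (hw0 x)
  have hawi : Integrable (fun x => a * w x) Q := hw.const_mul a
  have hk : ∀ k, ∫ x, (g k x).toReal ∂Q ≤ m + ∫ x, a * w x ∂Q := fun k => by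
    have := hm k
    rw [integral_sub (hgi k) hawi] at this
    linarith
  have hmw : 0 ≤ m + ∫ x, a * w x ∂Q :=
    (integral_nonneg fun x => ENNReal.toReal_nonneg).trans (hk 0)
  have hH : ∫⁻ x, (c x + (a * w x : ℝ)).toENNReal ∂Q
      ≤ ENNReal.ofReal (m + ∫ x, a * w x ∂Q) := by
    simp_rw [← hgc]
    rw [lintegral_iSup hgm hg]
    refine iSup_le fun k => ?_
    calc ∫⁻ x, g k x ∂Q = ∫⁻ x, ENNReal.ofReal (g k x).toReal ∂Q := by
          simp_rw [ENNReal.ofReal_toReal (hgt k _)]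
      _ = ENNReal.ofReal (∫ x, (g k x).toReal ∂Q) :=
          (ofReal_integral_eq_lintegral_ofReal (hgi k)
            (Eventually.of_forall fun x => ENNReal.toReal_nonneg)).symm
      _ ≤ _ := ENNReal.ofReal_le_ofReal (hk k)
  have hW : ∫⁻ x, ENNReal.ofReal (a * w x) ∂Q = ENNReal.ofReal (∫ x, a * w x ∂Q) :=
    (ofReal_integral_eq_lintegral_ofReal hawi (Eventually.of_forall haw)).symm
  have hsum : ∫⁻ x, (c x).toENNReal ∂Q + ENNReal.ofReal (∫ x, a * w x ∂Q)
      = ∫⁻ x, (c x + (a * w x : ℝ)).toENNReal ∂Q + ∫⁻ x, (-c x).toENNReal ∂Q := by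
    have hcn : Measurable fun x => (-c x).toENNReal := hc.neg.ereal_toENNReal
    rw [← hW, ← lintegral_add_left hc.ereal_toENNReal,
      ← lintegral_add_right _ hcn]
    refine lintegral_congr fun x => toENNReal_add_ofReal (haw x) ?_
    rw [← neg_mul]
    exact hac x
  have hB : ∫⁻ x, (-c x).toENNReal ∂Q ≠ ⊤ := by
    refine ne_top_of_le_ne_top (hW.trans_ne ENNReal.ofReal_ne_top)
      (lintegral_mono fun x => ?_)
    rw [← EReal.real_coe_toENNReal]
    refine EReal.toENNReal_le_toENNReal (EReal.neg_le.1 ?_)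
    rw [← EReal.coe_neg, ← neg_mul]
    exact hac x
  rw [expect]
  generalize ∫⁻ x, (c x).toENNReal ∂Q = I at *
  generalize ∫⁻ x, (-c x).toENNReal ∂Q = J at *
  generalize ∫⁻ x, (c x + (a * w x : ℝ)).toENNReal ∂Q = H at *
  have hI0 : 0 ≤ ∫ x, a * w x ∂Q := integral_nonneg haw
  generalize ∫ x, a * w x ∂Q = r at *
  have hH' : H ≠ ⊤ := ne_top_of_le_ne_top ENNReal.ofReal_ne_top hH
  have hI : I ≠ ⊤ := ne_top_of_le_ne_top (ENNReal.add_ne_top.2 ⟨hH', hB⟩)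
    (le_self_add.trans_eq hsum)
  have h1 := congrArg ENNReal.toReal hsum
  rw [ENNReal.toReal_add hI ENNReal.ofReal_ne_top, ENNReal.toReal_add hH' hB,
    ENNReal.toReal_ofReal hI0] at h1
  have h2 : H.toReal ≤ m + r := ENNReal.toReal_le_of_le_ofReal hmw hH
  rw [← EReal.coe_ennreal_toReal hI, ← EReal.coe_ennreal_toReal hB, ← EReal.coe_sub,
    EReal.coe_le_coe_iff]
  linarith

end Expect

/-! ### Representation of positive functionals by measures -/

section Representation

open scoped CompactlySupported

variable {ι : Type} [Fintype ι] {d : ℕ} {K : ι → Fin d → Set ℝ}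

lemma weight_nonneg (x : PathSpace K) : 0 ≤ weight x := zero_le_one.trans (one_le_weight x)

lemma continuous_weight : Continuous (weight : PathSpace K → ℝ) := by
  unfold weight
  fun_prop

lemma weight_mem_boundedSpace : (weight : PathSpace K → ℝ) ∈ boundedSpace K :=
  ⟨1, fun x => by rw [one_mul, abs_of_nonneg (weight_nonneg x)]⟩

lemma weight_mem_CSpace : (weight : PathSpace K → ℝ) ∈ CSpace K :=
  ⟨continuous_weight, weight_mem_boundedSpace⟩

lemma abs_apply_le_weight (x : PathSpace K) (i : ι) (j : Fin d) : |(x i j : ℝ)| ≤ weight x := by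
  calc |(x i j : ℝ)| ≤ ∑ j, |(x i j : ℝ)| :=
        Finset.single_le_sum (f := fun j => |(x i j : ℝ)|) (fun _ _ => abs_nonneg _)
          (Finset.mem_univ j)
    _ ≤ ∑ i, ∑ j, |(x i j : ℝ)| :=
        Finset.single_le_sum (f := fun i => ∑ j, |(x i j : ℝ)|)
          (fun _ _ => Finset.sum_nonneg fun _ _ => abs_nonneg _) (Finset.mem_univ i)
    _ ≤ weight x := le_add_of_nonneg_left zero_le_one

lemma isCompact_weight_le (hK : ∀ i j, IsClosed (K i j)) (R : ℝ) :
    IsCompact {x : PathSpace K | weight x ≤ R} := by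
  have hbox : IsCompact (Set.univ.pi fun i => Set.univ.pi fun j =>
      (Subtype.val ⁻¹' Set.Icc (-R) R : Set (K i j))) :=
    isCompact_univ_pi fun i => isCompact_univ_pi fun j =>
      (hK i j).isClosedEmbedding_subtypeVal.isCompact_preimage isCompact_Icc
  refine hbox.of_isClosed_subset (isClosed_le continuous_weight continuous_const) fun x hx => ?_
  exact fun i _ j _ => abs_le.1 ((abs_apply_le_weight x i j).trans hx)

lemma locallyCompactSpace_pathSpace (hK : ∀ i j, IsClosed (K i j)) :
    LocallyCompactSpace (PathSpace K) := by
  have : ∀ i j, LocallyCompactSpace (K i j) := fun i j => (hK i j).locallyCompactSpace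
  infer_instance

/-- A continuous cutoff, equal to `1` where the weight is at most `n`
and to `0` where it is at least `n + 1`. -/
def cutoff (n : ℕ) (x : PathSpace K) : ℝ := max 0 (min 1 (n + 1 - weight x))

lemma continuous_cutoff (n : ℕ) : Continuous (cutoff n : PathSpace K → ℝ) := by
  have := continuous_weight (K := K)
  unfold cutoff
  fun_prop

lemma cutoff_nonneg (n : ℕ) (x : PathSpace K) : 0 ≤ cutoff n x := le_max_left _ _

lemma cutoff_le_one (n : ℕ) (x : PathSpace K) : cutoff n x ≤ 1 :=
  max_le zero_le_one (min_le_left _ _)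

lemma cutoff_eq_one {n : ℕ} {x : PathSpace K} (h : weight x ≤ n) : cutoff n x = 1 := by
  rw [cutoff, min_eq_left (by linarith), max_eq_right zero_le_one]

lemma cutoff_mono (x : PathSpace K) : Monotone fun n => cutoff n x := fun m n hmn =>
  max_le_max le_rfl (min_le_min le_rfl (by gcongr))

lemma hasCompactSupport_mul_cutoff (hK : ∀ i j, IsClosed (K i j)) (φ : PathSpace K → ℝ) (n : ℕ) :
    HasCompactSupport fun x => φ x * cutoff n x := by
  refine HasCompactSupport.intro (isCompact_weight_le hK (n + 1)) fun x hx => ?_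
  have : (n : ℝ) + 1 < weight x := not_le.1 hx
  rw [cutoff, max_eq_left ((min_le_right _ _).trans (by linarith)), mul_zero]

lemma mem_boundedSpace_of_hasCompactSupport {φ : PathSpace K → ℝ} (hφ : Continuous φ)
    (hs : HasCompactSupport φ) : φ ∈ boundedSpace K := by
  obtain ⟨M, hM⟩ := hs.exists_bound_of_continuous hφ
  refine ⟨|M|, fun x => ((hM x).trans (le_abs_self M)).trans ?_⟩
  exact le_mul_of_one_le_right (abs_nonneg M) (one_le_weight x)

/-- The constant `r` as an element of `boundedSpace K`. -/
def constBd (K : ι → Fin d → Set ℝ) (r : ℝ) : boundedSpace K :=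
  ⟨fun _ => r, const_mem_boundedSpace K r⟩

lemma map_mono_of_nonneg {l : boundedSpace K →ₗ[ℝ] ℝ}
    (hpos : ∀ u : boundedSpace K, (∀ x, 0 ≤ u.1 x) → 0 ≤ l u) {u v : boundedSpace K}
    (h : ∀ x, u.1 x ≤ v.1 x) : l u ≤ l v := by
  have := hpos (v - u) fun x => sub_nonneg.2 (h x)
  rwa [map_sub, sub_nonneg] at this

/-- Riesz–Markov. Mass may still escape to infinity here; only tightness extends the formula beyond
compact support. -/
lemma exists_measure_compactSupport (hK : ∀ i j, IsClosed (K i j)) {l : boundedSpace K →ₗ[ℝ] ℝ}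
    (hpos : ∀ u : boundedSpace K, (∀ x, 0 ≤ u.1 x) → 0 ≤ l u) :
    ∃ Q : Measure (PathSpace K), IsFiniteMeasureOnCompacts Q ∧
      ∀ (φ : PathSpace K → ℝ) (hφ : Continuous φ) (hs : HasCompactSupport φ),
      ∫ x, φ x ∂Q = l ⟨φ, mem_boundedSpace_of_hasCompactSupport hφ hs⟩ := by
  have := locallyCompactSpace_pathSpace hK
  let Λ₀ : C_c(PathSpace K, ℝ) →ₗ[ℝ] ℝ :=
    { toFun := fun f => l ⟨f, mem_boundedSpace_of_hasCompactSupport f.continuous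
        f.hasCompactSupport⟩
      map_add' := fun f g => by rw [← map_add]; rfl
      map_smul' := fun r f => by rw [← map_smul]; rfl }
  let Λ : C_c(PathSpace K, ℝ) →ₚ[ℝ] ℝ := PositiveLinearMap.mk₀ Λ₀ fun f hf => hpos _ fun x => hf x
  exact ⟨RealRMK.rieszMeasure Λ, inferInstance,
    fun φ hφ hs => RealRMK.integral_rieszMeasure Λ ⟨⟨φ, hφ⟩, hs⟩⟩

/-- For `φ ≥ 0` the truncations `φ * cutoff n` increase to `φ`. The integrals converge by monotone
convergence, the values of `l` because the remainder is dominated by a multiple of `F`. -/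
theorem exists_measure_of_tight (hK : ∀ i j, IsClosed (K i j)) {l : boundedSpace K →ₗ[ℝ] ℝ}
    (hpos : ∀ u : boundedSpace K, (∀ x, 0 ≤ u.1 x) → 0 ≤ l u) (hone : l (constBd K 1) = 1)
    (htight : ∀ ε : ℝ, 0 < ε → ∃ (R : ℝ) (F : boundedSpace K), (∀ x, 0 ≤ F.1 x) ∧
      (∀ x, R < weight x → weight x ≤ F.1 x) ∧ l F ≤ ε) :
    ∃ Q : Measure (PathSpace K), IsProbabilityMeasure Q ∧
      ∀ φ (h : φ ∈ CSpace K), Integrable φ Q ∧ ∫ x, φ x ∂Q = l ⟨φ, h.2⟩ := by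
  obtain ⟨Q, hQf, hQ⟩ := exists_measure_compactSupport hK hpos
  have key : ∀ φ (h : φ ∈ CSpace K), (∀ x, 0 ≤ φ x) →
      ∫⁻ x, ENNReal.ofReal (φ x) ∂Q = ENNReal.ofReal (l ⟨φ, h.2⟩) := by
    intro φ h hφ
    have hc : ∀ n : ℕ, Continuous fun x => φ x * cutoff n x :=
      fun n => h.1.mul (continuous_cutoff n)
    have hs := hasCompactSupport_mul_cutoff hK φ
    let ψ : ℕ → boundedSpace K := fun n =>
      ⟨fun x => φ x * cutoff n x, mem_boundedSpace_of_hasCompactSupport (hc n) (hs n)⟩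
    have hψ : ∀ n, ∫⁻ x, ENNReal.ofReal (φ x * cutoff n x) ∂Q = ENNReal.ofReal (l (ψ n)) := by
      intro n
      rw [← hQ _ (hc n) (hs n), ofReal_integral_eq_lintegral_ofReal
        ((hc n).integrable_of_hasCompactSupport (hs n))
        (Eventually.of_forall fun x => mul_nonneg (hφ x) (cutoff_nonneg n x))]
    have hlim : Tendsto (fun n => l (ψ n)) atTop (𝓝 (l ⟨φ, h.2⟩)) := by
      obtain ⟨M, hM⟩ := h.2
      rw [Metric.tendsto_atTop]
      intro ε hε
      obtain ⟨R, F, hF0, hF, hlF⟩ := htight (ε / (2 * (|M| + 1))) (by positivity)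
      obtain ⟨N, hN⟩ := exists_nat_ge R
      refine ⟨N, fun n hn => ?_⟩
      have h1 : l (ψ n) ≤ l ⟨φ, h.2⟩ := map_mono_of_nonneg hpos fun x =>
        mul_le_of_le_one_right (hφ x) (cutoff_le_one n x)
      have h2 : l ⟨φ, h.2⟩ ≤ l (ψ n + (|M| + 1) • F) := by
        refine map_mono_of_nonneg hpos fun x => ?_
        change φ x ≤ φ x * cutoff n x + (|M| + 1) * F.1 x
        rcases le_or_gt (weight x) R with hx | hx
        · rw [cutoff_eq_one (hx.trans (hN.trans (by exact_mod_cast hn))), mul_one]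
          have := hF0 x
          exact le_add_of_nonneg_right (by positivity)
        · refine le_add_of_nonneg_of_le (mul_nonneg (hφ x) (cutoff_nonneg n x)) ?_
          calc φ x ≤ M * weight x := (le_abs_self _).trans (hM x)
            _ ≤ (|M| + 1) * F.1 x := by
              have := le_abs_self M
              exact mul_le_mul (by linarith) (hF x hx) (weight_nonneg x) (by positivity)
      rw [map_add, map_smul, smul_eq_mul] at h2
      have h3 : (|M| + 1) * l F ≤ ε / 2 := by
        calc (|M| + 1) * l F ≤ (|M| + 1) * (ε / (2 * (|M| + 1))) := by gcongr
          _ = ε / 2 := by field_simp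
      rw [Real.dist_eq, abs_lt]
      constructor <;> linarith
    have hmct : Tendsto (fun n : ℕ => ∫⁻ x, ENNReal.ofReal (φ x * cutoff n x) ∂Q) atTop
        (𝓝 (∫⁻ x, ENNReal.ofReal (φ x) ∂Q)) := by
      refine lintegral_tendsto_of_tendsto_of_monotone
        (fun n => (hc n).measurable.ennreal_ofReal.aemeasurable)
        (Eventually.of_forall fun x m n hmn => ?_) (Eventually.of_forall fun x => ?_)
      · exact ENNReal.ofReal_le_ofReal (mul_le_mul_of_nonneg_left (cutoff_mono x hmn) (hφ x))
      · obtain ⟨N, hN⟩ := exists_nat_ge (weight x)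
        refine tendsto_const_nhds.congr' ?_
        filter_upwards [eventually_ge_atTop N] with n hn
        rw [cutoff_eq_one (hN.trans (by exact_mod_cast hn)), mul_one]
    simp_rw [hψ] at hmct
    exact tendsto_nhds_unique hmct (ENNReal.tendsto_ofReal hlim)
  have key2 : ∀ φ (h : φ ∈ CSpace K), (∀ x, 0 ≤ φ x) →
      Integrable φ Q ∧ ∫ x, φ x ∂Q = l ⟨φ, h.2⟩ := by
    intro φ h hφ
    have h0 := Eventually.of_forall (f := ae Q) hφ
    have hm : AEStronglyMeasurable φ Q := h.1.aestronglyMeasurable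
    refine ⟨⟨hm, ?_⟩, ?_⟩
    · rw [hasFiniteIntegral_iff_ofReal h0, key φ h hφ]
      exact ENNReal.ofReal_lt_top
    · rw [integral_eq_lintegral_of_nonneg_ae h0 hm, key φ h hφ,
        ENNReal.toReal_ofReal (hpos _ hφ)]
  refine ⟨Q, ⟨?_⟩, fun φ h => ?_⟩
  · have := key _ (constC K 1).2 fun _ => zero_le_one
    change _ = ENNReal.ofReal (l (constBd K 1)) at this
    simpa [constC, hone] using this
  · obtain ⟨M, hM⟩ := h.2
    -- Adding `|M| • weight` makes `φ` nonnegative and reduces the signed case to `key2`.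
    have hw' := (CSpace K).smul_mem |M| weight_mem_CSpace
    obtain ⟨hi, he⟩ := key2 _ hw' fun x => mul_nonneg (abs_nonneg M) (weight_nonneg x)
    obtain ⟨hi', he'⟩ := key2 _ ((CSpace K).add_mem h hw') fun x => by
      have h1 := neg_le_of_abs_le (hM x)
      have h2 := mul_le_mul_of_nonneg_right (le_abs_self M) (weight_nonneg x)
      change 0 ≤ φ x + |M| * weight x
      linarith
    have hφ : φ = (φ + |M| • weight) - |M| • weight := by simp
    refine ⟨by rw [hφ]; exact hi'.sub hi, ?_⟩
    have h3 : l ⟨φ, h.2⟩ = l ⟨φ + |M| • weight, ((CSpace K).add_mem h hw').2⟩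
        - l ⟨|M| • weight, hw'.2⟩ := by
      rw [← map_sub]
      congr 1
      exact Subtype.ext hφ
    rw [h3, ← he, ← he', ← integral_sub hi' hi]
    exact congrArg (fun f => ∫ x, f x ∂Q) hφ

end Representation

/-! ### The total payoff of a hedging instrument -/

variable {d T : ℕ} {K : Fin (T + 1) → Fin d → Set ℝ}
  {E : ∀ t, Submodule ℝ (CSpace (upTo K t))}

lemma continuous_hist (t : Fin (T + 1)) : Continuous (hist t : PathSpace K → _) := by
  unfold hist
  fun_prop

lemma weight_hist_le (t : Fin (T + 1)) (x : PathSpace K) : weight (hist t x) ≤ weight x := by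
  refine add_le_add le_rfl ?_
  have h : ∑ i : Set.Iic t, ∑ j, |(hist t x i j : ℝ)|
      = ∑ i ∈ (Set.Iic t).toFinset, ∑ j, |(x i j : ℝ)| :=
    (Finset.sum_subtype _ (fun i => by simp) fun i => ∑ j, |(x i j : ℝ)|).symm
  rw [h]
  exact Finset.sum_le_sum_of_subset_of_nonneg (Finset.subset_univ _)
    fun _ _ _ => Finset.sum_nonneg fun _ _ => abs_nonneg _

lemma Hedge.eval_mem (φ : Hedge E) (t : Fin (T + 1)) : φ.eval t ∈ CSpace K := by
  refine ⟨(φ t).1.2.1.comp (continuous_hist t), ?_⟩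
  obtain ⟨M, hM⟩ := (φ t).1.2.2
  refine ⟨|M|, fun x => (hM _).trans ?_⟩
  exact mul_le_mul (le_abs_self M) (weight_hist_le t x) (weight_nonneg _) (abs_nonneg M)

/-- The payoff `∑ₜ φₜ(x₀, …, xₜ)` as an element of `C_{0:T}`. -/
def Hedge.total (φ : Hedge E) : CSpace K := ∑ t, ⟨φ.eval t, φ.eval_mem t⟩

lemma Hedge.total_apply (φ : Hedge E) (x : PathSpace K) : φ.total.1 x = ∑ t, φ.eval t x := by
  simp [Hedge.total]

lemma Hedge.total_add (φ ψ : Hedge E) : (φ + ψ).total = φ.total + ψ.total := by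
  rw [Hedge.total, Hedge.total, Hedge.total, ← Finset.sum_add_distrib]
  rfl

lemma Hedge.total_smul (r : ℝ) (φ : Hedge E) : (r • φ).total = r • φ.total := by
  rw [Hedge.total, Hedge.total, Finset.smul_sum]
  rfl

lemma Hedge.total_neg (φ : Hedge E) : (-φ).total = -φ.total := by
  rw [Hedge.total, Hedge.total, ← Finset.sum_neg_distrib]
  rfl

lemma total_constHedge_apply (hE : HasConstants E) (β : Fin (T + 1) → ℝ) (x : PathSpace K) :
    (constHedge hE β).total.1 x = ∑ t, β t :=
  Hedge.total_apply _ x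

lemma pairing_eq_integral {Q : Measure (PathSpace K)} (hQ : Q ∈ Prob1 K) (φ : Hedge E) :
    pairing φ Q = ∫ x, φ.total.1 x ∂Q := by
  simp_rw [Hedge.total_apply]
  rw [integral_finsetSum _ fun t _ => hQ.2 _ (φ.eval_mem t), pairing]
  refine Finset.sum_congr rfl fun t _ => ?_
  exact integral_map (continuous_hist t).aemeasurable (φ t).1.2.1.aestronglyMeasurable

lemma pairing_neg (φ : Hedge E) (Q : Measure (PathSpace K)) : pairing (-φ) Q = -pairing φ Q := by
  rw [pairing, pairing, ← Finset.sum_neg_distrib]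
  exact Finset.sum_congr rfl fun t _ => integral_neg _

/-! ### Subhedging values -/

/-- `r` is the value of a subhedge of `c`: a position `z + φ - s` with `z ∈ -A`
that is dominated by `c` and for which `r + s ≤ U(φ)`. -/
def IsSubhedge (U : Hedge E → EReal) (A : ConvexCone ℝ (CSpace K)) (c : PathSpace K → EReal)
    (r : ℝ) : Prop :=
  ∃ (z : CSpace K) (φ : Hedge E) (s : ℝ), -z ∈ A ∧
    (∀ x, ((φ.total.1 x + z.1 x - s : ℝ) : EReal) ≤ c x) ∧ ((r + s : ℝ) : EReal) ≤ U φ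

variable {U : Hedge E → EReal} {A : ConvexCone ℝ (CSpace K)}

lemma IsSubhedge.le_P {c : PathSpace K → EReal} {r : ℝ} (hE : HasConstants E)
    (h : IsSubhedge U A c r) : (r : EReal) ≤ P hE U A c := by
  obtain ⟨z, φ, s, hz, hc, hU⟩ := h
  -- All cash is placed at time `0`; only its total matters, since `SU` adds back the `β` that is
  -- subtracted from `φ`.
  have hβ : ∑ t, (Pi.single 0 s : Fin (T + 1) → ℝ) t = s := by simp
  set β : Fin (T + 1) → ℝ := Pi.single 0 s
  have hS : (r : EReal) ≤ SU hE U (φ - constHedge hE β) := by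
    refine le_iSup_of_le β ?_
    have e : φ - constHedge hE β + constHedge hE β = φ :=
      funext fun t => sub_add_cancel (φ t) _
    rw [e, hβ]
    refine le_trans ?_ (EReal.sub_le_sub hU le_rfl)
    rw [← EReal.coe_sub, add_sub_cancel_right]
  refine hS.trans (le_iSup₂_of_le z hz (le_iSup₂_of_le (φ - constHedge hE β) ⟨?_, ?_⟩ le_rfl))
  · exact (EReal.bot_lt_coe r).trans_le hS
  · intro x
    convert hc x using 2
    rw [← Hedge.total_apply, sub_eq_add_neg φ, Hedge.total_add, Hedge.total_neg]
    change φ.total.1 x + -(constHedge hE β).total.1 x + z.1 x = _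
    rw [total_constHedge_apply, hβ]
    ring

/-- Each `β` in `SU` yields a subhedge with hedge `φ + β` and cash `∑ t, β t`. With
`IsSubhedge.le_P` this identifies `P` as the supremum of subhedge values. -/
lemma P_le {c : PathSpace K → EReal} {m : EReal} (hE : HasConstants E) (hU_top : ∀ φ, U φ ≠ ⊤)
    (h : ∀ r : ℝ, IsSubhedge U A c r → (r : EReal) ≤ m) : P hE U A c ≤ m := by
  refine iSup₂_le fun z hz => iSup₂_le fun φ hφ => iSup_le fun β => ?_
  rcases eq_or_ne (U (φ + constHedge hE β)) ⊥ with hb | hb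
  · rw [hb, EReal.bot_sub]
    exact bot_le
  · lift U (φ + constHedge hE β) to ℝ using ⟨hU_top _, hb⟩ with v hv
    rw [← EReal.coe_sub]
    refine h _ ⟨z, φ + constHedge hE β, ∑ t, β t, hz, fun x => ?_, ?_⟩
    · convert hφ.2 x using 2
      rw [← Hedge.total_apply, Hedge.total_add]
      change φ.total.1 x + (constHedge hE β).total.1 x + z.1 x - _ = _
      rw [total_constHedge_apply]
      ring
    · rw [sub_add_cancel, hv]

lemma IsSubhedge.mono_add {c c' : PathSpace K → EReal} {r b : ℝ} (h : IsSubhedge U A c r)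
    (hc : ∀ x, c x + b ≤ c' x) : IsSubhedge U A c' (r + b) := by
  obtain ⟨z, φ, s, hz, hφ, hU⟩ := h
  refine ⟨z, φ, s - b, hz, fun x => le_trans ?_ (hc x), ?_⟩
  · convert add_le_add_left (hφ x) (b : EReal) using 1
    rw [← EReal.coe_add]
    congr 1
    ring
  · rwa [add_add_sub_cancel]

lemma IsSubhedge.mono {c c' : PathSpace K → EReal} {r : ℝ} (h : IsSubhedge U A c r)
    (hc : ∀ x, c x ≤ c' x) : IsSubhedge U A c' r := by
  simpa using h.mono_add (b := 0) (by simpa using hc)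

/-- Hedge payoffs are real, so `hc` need only test real minorants; this avoids products such as `0 *
⊤`. -/
lemma IsSubhedge.convex_comb {c₁ c₂ c : PathSpace K → EReal} {r₁ r₂ a b : ℝ}
    (hU_conc : IsConcave U) (h₁ : IsSubhedge U A c₁ r₁) (h₂ : IsSubhedge U A c₂ r₂)
    (ha : 0 ≤ a) (hb : 0 ≤ b) (hab : a + b = 1)
    (hc : ∀ x (y₁ y₂ : ℝ), (y₁ : EReal) ≤ c₁ x → (y₂ : EReal) ≤ c₂ x →
      ((a * y₁ + b * y₂ : ℝ) : EReal) ≤ c x) : IsSubhedge U A c (a * r₁ + b * r₂) := by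
  obtain ⟨z₁, φ₁, s₁, hz₁, hφ₁, hU₁⟩ := h₁
  obtain ⟨z₂, φ₂, s₂, hz₂, hφ₂, hU₂⟩ := h₂
  refine ⟨a • z₁ + b • z₂, a • φ₁ + b • φ₂, a * s₁ + b * s₂, ?_, fun x => ?_, ?_⟩
  · have h : a • -z₁ + b • -z₂ ∈ A := A.convex hz₁ hz₂ ha hb hab
    rwa [smul_neg, smul_neg, ← neg_add] at h
  · convert hc x _ _ (hφ₁ x) (hφ₂ x) using 2
    rw [Hedge.total_add, Hedge.total_smul, Hedge.total_smul]
    change a * φ₁.total.1 x + b * φ₂.total.1 x + (a * z₁.1 x + b * z₂.1 x) - _ = _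
    ring
  · refine le_trans ?_ (hU_conc φ₁ φ₂ a b ha hb hab)
    calc ((a * r₁ + b * r₂ + (a * s₁ + b * s₂) : ℝ) : EReal)
        = (a : EReal) * ((r₁ + s₁ : ℝ) : EReal) + (b : EReal) * ((r₂ + s₂ : ℝ) : EReal) := by
          rw [← EReal.coe_mul, ← EReal.coe_mul, ← EReal.coe_add]
          congr 1
          ring
      _ ≤ _ := add_le_add (mul_le_mul_of_nonneg_left hU₁ (EReal.coe_nonneg.2 ha))
        (mul_le_mul_of_nonneg_left hU₂ (EReal.coe_nonneg.2 hb))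

/-- The weight is bounded on a product of compact sets, so a sublevel set of `weight` can replace
it. The value `-1` is an arbitrary negative bound. -/
lemma CallsVanish.exists_dominating (h : CallsVanish U) {Γ : ℝ} (hΓ : 0 < Γ) :
    ∃ (F : Hedge E) (R : ℝ), (∀ x, 0 ≤ F.total.1 x) ∧
      (∀ x, R < weight x → weight x ≤ F.total.1 x) ∧ ((-1 : ℝ) : EReal) ≤ U (-(Γ • F)) := by
  obtain ⟨C, f, hC, hf, hw, hV⟩ := h
  have h1 : ∀ᶠ n in atTop, V U (Γ • f n) < ((1 : ℝ) : EReal) :=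
    (hV Γ hΓ).eventually_lt_const (by simp)
  obtain ⟨n, hn⟩ := h1.exists
  obtain ⟨R, hR⟩ := (isCompact_univ_pi fun t => hC t n).bddAbove_image
    (continuous_weight (K := K)).continuousOn
  refine ⟨f n, R, fun x => ?_, fun x hx => ?_, ?_⟩
  · rw [Hedge.total_apply]
    exact Finset.sum_nonneg fun t _ => hf n t _
  · rw [Hedge.total_apply]
    refine hw n x fun hxC => hx.not_ge (hR ⟨x, fun t _ => hxC t, rfl⟩)
  · rw [EReal.coe_neg]
    exact EReal.neg_le.1 hn.le

/-- Being short `|a| + 1` units of `F` covers `-a * weight` beyond level `R`; cash `(|a| + 1) * |R|`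
covers the rest. -/
lemma CallsVanish.exists_isSubhedge (h : CallsVanish U) (hA : (0 : CSpace K) ∈ A)
    {c : PathSpace K → EReal} {a : ℝ} (hc : ∀ x, ((-a * weight x : ℝ) : EReal) ≤ c x) :
    ∃ r, IsSubhedge U A c r := by
  obtain ⟨F, R, hF0, hF, hU⟩ := h.exists_dominating (Γ := |a| + 1) (by positivity)
  refine ⟨-1 - (|a| + 1) * |R|, 0, -((|a| + 1) • F), (|a| + 1) * |R|, by simpa using hA,
    fun x => le_trans ?_ (hc x), by simpa using hU⟩
  rw [EReal.coe_le_coe_iff, Hedge.total_neg, Hedge.total_smul]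
  change -((|a| + 1) * F.total.1 x) + 0 - (|a| + 1) * |R| ≤ -a * weight x
  have h1 : weight x ≤ F.total.1 x + |R| := by
    rcases le_or_gt (weight x) R with hx | hx
    · linarith [hF0 x, le_abs_self R]
    · linarith [hF x hx, abs_nonneg R]
  have h2 : a * weight x ≤ (|a| + 1) * (F.total.1 x + |R|) :=
    mul_le_mul (by linarith [le_abs_self a]) h1 (weight_nonneg x) (by positivity)
  linarith

/-! ### The subhedging functional on perturbations of a fixed payoff -/

/-- Perturbations range over all functions of linear growth, measurable or not. The payoff `c = 0`
serves part (i), and a semicontinuous `c` with values up to `⊤` serves the duality. -/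
theorem exists_real_P (hE : HasConstants E) (hU_top : ∀ φ, U φ ≠ ⊤) (hU_conc : IsConcave U)
    (hA : (0 : CSpace K) ∈ A) (hcalls : CallsVanish U) {c : PathSpace K → EReal} {a : ℝ}
    (hc : ∀ x, ((-a * weight x : ℝ) : EReal) ≤ c x) {u₀ : boundedSpace K}
    (hu₀ : P hE U A (fun x => c x + (u₀.1 x : ℝ)) < ⊤) :
    ∃ p : boundedSpace K → ℝ,
      (∀ u, P hE U A (fun x => c x + (u.1 x : ℝ)) = p u) ∧
      (∀ u r, IsSubhedge U A (fun x => c x + (u.1 x : ℝ)) r → r ≤ p u) ∧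
      ConcaveOn ℝ Set.univ p ∧
      (∀ u v : boundedSpace K, (∀ x, u.1 x ≤ v.1 x) → p u ≤ p v) ∧
      (∀ u r, p (u + constBd K r) = p u + r) := by
  let S : boundedSpace K → Set ℝ := fun u => {r | IsSubhedge U A (fun x => c x + (u.1 x : ℝ)) r}
  have hcomb : ∀ (u v : boundedSpace K) (a b : ℝ), 0 ≤ a → 0 ≤ b → a + b = 1 →
      ∀ r ∈ S u, ∀ r' ∈ S v, a * r + b * r' ∈ S (a • u + b • v) := by
    intro u v a b ha hb hab r hr r' hr'
    refine IsSubhedge.convex_comb hU_conc hr hr' ha hb hab fun x y₁ y₂ h₁ h₂ => ?_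
    change _ ≤ c x + ((a * u.1 x + b * v.1 x : ℝ) : EReal)
    generalize c x = y at h₁ h₂ ⊢
    induction y with
    | bot => simp at h₁
    | top => exact le_top.trans_eq (EReal.top_add_coe _).symm
    | coe c =>
      rw [← EReal.coe_add, EReal.coe_le_coe_iff] at h₁ h₂ ⊢
      have e : c + (a * u.1 x + b * v.1 x) = a * (c + u.1 x) + b * (c + v.1 x) := by
        linear_combination (-c) * hab
      rw [e]
      gcongr
  have hne : ∀ u, (S u).Nonempty := by
    intro u
    obtain ⟨M, hM⟩ := u.2
    refine hcalls.exists_isSubhedge hA (a := a + M) fun x => ?_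
    calc ((-(a + M) * weight x : ℝ) : EReal) ≤ ((-a * weight x + u.1 x : ℝ) : EReal) := by
          rw [EReal.coe_le_coe_iff]
          linarith [neg_le_of_abs_le (hM x)]
      _ ≤ _ := by
          rw [EReal.coe_add]
          exact add_le_add_left (hc x) _
  have hbdd : ∀ u, BddAbove (S u) := by
    intro u
    obtain ⟨M, hM, -⟩ := EReal.lt_iff_exists_real_btwn.1 hu₀
    -- `u₀` is the midpoint of `u` and its reflection, so one value at the reflection and a bound at
    -- `u₀` bound all values at `u`.
    obtain ⟨r', hr'⟩ := hne ((2 : ℝ) • u₀ - u)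
    refine ⟨2 * M - r', fun r hr => ?_⟩
    have h := hcomb u _ (1 / 2) (1 / 2) (by norm_num) (by norm_num) (by norm_num) r hr r' hr'
    have e : (1 / 2 : ℝ) • u + (1 / 2 : ℝ) • ((2 : ℝ) • u₀ - u) = u₀ := by
      rw [smul_sub, smul_smul, add_sub_cancel]
      norm_num
    rw [e] at h
    have := (IsSubhedge.le_P hE h).trans hM.le
    rw [EReal.coe_le_coe_iff] at this
    linarith
  refine ⟨fun u => sSup (S u), fun u => ?_, fun u r hr => le_csSup (hbdd u) hr, ⟨convex_univ, ?_⟩,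
    ?_, ?_⟩
  · have hle : P hE U A (fun x => c x + (u.1 x : ℝ)) ≤ ((sSup (S u) : ℝ) : EReal) :=
      P_le hE hU_top fun r hr => EReal.coe_le_coe_iff.2 (le_csSup (hbdd u) hr)
    refine le_antisymm hle ?_
    have hge : ∀ r ∈ S u, (r : EReal) ≤ P hE U A (fun x => c x + (u.1 x : ℝ)) :=
      fun r hr => IsSubhedge.le_P hE hr
    obtain ⟨r₀, hr₀⟩ := hne u
    lift P hE U A (fun x => c x + (u.1 x : ℝ)) to ℝ using
      ⟨(hle.trans_lt (EReal.coe_lt_top _)).ne, ((EReal.bot_lt_coe _).trans_le (hge r₀ hr₀)).ne'⟩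
      with q
    exact EReal.coe_le_coe_iff.2 (csSup_le ⟨r₀, hr₀⟩ fun r hr => EReal.coe_le_coe_iff.1 (hge r hr))
  · intro u _ v _ a b ha hb hab
    refine le_of_forall_pos_le_add fun ε hε => ?_
    obtain ⟨r, hr, hru⟩ := exists_lt_of_lt_csSup (hne u) (sub_lt_self (sSup (S u)) hε)
    obtain ⟨r', hr', hrv⟩ := exists_lt_of_lt_csSup (hne v) (sub_lt_self (sSup (S v)) hε)
    have h := le_csSup (hbdd _) (hcomb u v a b ha hb hab r hr r' hr')
    calc a • sSup (S u) + b • sSup (S v) ≤ a * (r + ε) + b * (r' + ε) := by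
          rw [smul_eq_mul, smul_eq_mul]
          gcongr <;> linarith
      _ = a * r + b * r' + (a + b) * ε := by ring
      _ ≤ _ := by
          rw [hab, one_mul]
          gcongr
  · intro u v huv
    refine csSup_le_csSup (hbdd v) (hne u) fun r hr => IsSubhedge.mono hr fun x => ?_
    exact add_le_add_right (EReal.coe_le_coe_iff.2 (huv x)) _
  · have hshift : ∀ u r, ∀ s ∈ S u, s + r ∈ S (u + constBd K r) := by
      intro u r s hs
      refine IsSubhedge.mono_add hs fun x => ?_
      change c x + (u.1 x : ℝ) + r ≤ c x + ((u.1 x + r : ℝ) : EReal)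
      rw [EReal.coe_add, add_assoc]
    intro u r
    refine le_antisymm (csSup_le (hne _) fun s hs => ?_) ?_
    · have h := hshift _ (-r) s hs
      have e : u + constBd K r + constBd K (-r) = u := by
        ext x
        exact add_neg_cancel_right (u.1 x) r
      rw [e] at h
      linarith [le_csSup (hbdd u) h]
    · rw [← le_sub_iff_add_le]
      refine csSup_le (hne _) fun s hs => ?_
      linarith [le_csSup (hbdd _) (hshift u r s hs)]

/-! ### Continuity in the weighted norm -/

lemma abs_le_wNorm_mul_weight {u : PathSpace K → ℝ} (hu : u ∈ boundedSpace K) (x : PathSpace K) :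
    |u x| ≤ wNorm u * weight x := by
  obtain ⟨M, hM⟩ := hu
  have hw : ∀ y : PathSpace K, 0 < weight y := fun y => zero_lt_one.trans_le (one_le_weight y)
  rw [← div_le_iff₀ (hw x)]
  refine le_ciSup (f := fun y => |u y| / weight y) ⟨M, ?_⟩ x
  rintro _ ⟨y, rfl⟩
  exact (div_le_iff₀ (hw y)).2 (hM y)

/-- A small weighted norm squeezes `v` between `u ± (δ / 2) • weight`. By monotonicity it suffices
that `p` is continuous along this line, where it is a finite concave function of one real variable.
-/
lemma exists_wNorm_lt_of_concaveOn_of_mono {p : boundedSpace K → ℝ}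
    (hconc : ConcaveOn ℝ Set.univ p)
    (hmono : ∀ u v : boundedSpace K, (∀ x, u.1 x ≤ v.1 x) → p u ≤ p v)
    (u : boundedSpace K) {ε : ℝ} (hε : 0 < ε) :
    ∃ δ : ℝ, 0 < δ ∧ ∀ v : boundedSpace K, wNorm (v - u).1 < δ → |p v - p u| < ε := by
  let w : boundedSpace K := ⟨weight, weight_mem_boundedSpace⟩
  let q : ℝ → ℝ := fun s => p (u + s • w)
  have hq : ConcaveOn ℝ Set.univ q :=
    hconc.comp_affineMap (AffineMap.lineMap u (u + w)) |>.congr fun s _ => by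
      simp [q, AffineMap.lineMap_apply, add_comm]
  have hqc : Continuous q := continuousOn_univ.1 (hq.continuousOn isOpen_univ)
  have hq0 : q 0 = p u := by simp [q]
  obtain ⟨δ, hδ, hball⟩ := Metric.continuous_iff.1 hqc 0 ε hε
  refine ⟨δ / 2, half_pos hδ, fun v hv => ?_⟩
  have hvx : ∀ x, |v.1 x - u.1 x| ≤ δ / 2 * weight x := fun x =>
    (abs_le_wNorm_mul_weight (v - u).2 x).trans
      (mul_le_mul_of_nonneg_right hv.le (weight_nonneg x))
  have h1 : p v ≤ q (δ / 2) := hmono _ _ fun x => by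
    change v.1 x ≤ u.1 x + δ / 2 * weight x
    linarith [(abs_le.1 (hvx x)).2]
  have h2 : q (-(δ / 2)) ≤ p v := hmono _ _ fun x => by
    change u.1 x + -(δ / 2) * weight x ≤ v.1 x
    linarith [(abs_le.1 (hvx x)).1]
  have h3 := hball (δ / 2) (by rw [Real.dist_eq, sub_zero, abs_of_pos (half_pos hδ)]; linarith)
  have h4 := hball (-(δ / 2))
    (by rw [Real.dist_eq, sub_zero, abs_neg, abs_of_pos (half_pos hδ)]; linarith)
  rw [Real.dist_eq, hq0, abs_lt] at h3 h4
  rw [abs_lt]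
  constructor <;> linarith

/-! ### Duality -/

theorem P_le_expect_add_D (hE : HasConstants E) (hU_top : ∀ φ, U φ ≠ ⊤)
    {c : PathSpace K → EReal} {Q : Measure (PathSpace K)} (hQ : Q ∈ Prob1Polar A) :
    P hE U A c ≤ expect Q c + D U Q := by
  have := hQ.1.1
  refine P_le hE hU_top ?_
  rintro r ⟨z, φ, s, hz, hc, hU⟩
  have hi : Integrable (fun x => φ.total.1 x + z.1 x) Q :=
    (hQ.1.2 _ φ.total.2).add (hQ.1.2 _ z.2)
  have h1 := integral_le_expect (hi.sub (integrable_const s)) hc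
  have h2 : ∫ x, (φ.total.1 x + z.1 x - s) ∂Q = pairing φ Q + ∫ x, z.1 x ∂Q - s := by
    rw [integral_sub hi (integrable_const s), integral_add (hQ.1.2 _ φ.total.2) (hQ.1.2 _ z.2),
      pairing_eq_integral hQ.1, integral_const]
    simp
  have h3 : 0 ≤ ∫ x, z.1 x ∂Q := by
    have := hQ.2 (-z) hz
    change ∫ x, -z.1 x ∂Q ≤ 0 at this
    rw [integral_neg] at this
    linarith
  have h4 : ((r + s - pairing φ Q : ℝ) : EReal) ≤ D U Q := by
    refine le_trans ?_ (le_iSup (fun φ => U φ - (pairing φ Q : EReal)) φ)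
    rw [EReal.coe_sub]
    exact EReal.sub_le_sub hU le_rfl
  refine le_trans ?_ (add_le_add h1 h4)
  rw [← EReal.coe_add, EReal.coe_le_coe_iff]
  simp only [Pi.sub_apply] at *
  rw [h2]
  linarith

lemma D_eq_iSup_pairing_sub_V (Q : Measure (PathSpace K)) :
    D U Q = ⨆ φ : Hedge E, (pairing φ Q : EReal) - V U φ := by
  rw [D, ← (Equiv.neg (Hedge E)).iSup_comp]
  refine iSup_congr fun φ => ?_
  rw [V, Equiv.neg_apply, pairing_neg, EReal.coe_neg, sub_eq_add_neg, sub_eq_add_neg, neg_neg,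
    neg_neg, add_comm]

/-- A supporting functional of `u ↦ 𝔓(c + u)` at the origin is given by a measure. -/
theorem exists_measure_integral_add_le (hK : ∀ t j, IsClosed (K t j)) (hE : HasConstants E)
    (hU_top : ∀ φ, U φ ≠ ⊤) (hU_conc : IsConcave U) (hU_zero : U 0 ≠ ⊥)
    (hA : (0 : CSpace K) ∈ A) (hcalls : CallsVanish U) {c : PathSpace K → EReal} {a : ℝ}
    (hc : ∀ x, ((-a * weight x : ℝ) : EReal) ≤ c x) (hP : P hE U A c < ⊤) :
    ∃ (m : ℝ) (Q : Measure (PathSpace K)), P hE U A c = m ∧ Q ∈ Prob1Polar A ∧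
      ∀ (g : CSpace K) (φ : Hedge E) (v : ℝ), (∀ x, (g.1 x : EReal) ≤ c x) → (v : EReal) ≤ U φ →
        ∫ x, g.1 x ∂Q + v - pairing φ Q ≤ m := by
  have hc0 : (fun x => c x + (((0 : boundedSpace K).1 x : ℝ) : EReal)) = c := by
    funext x
    exact add_zero (c x)
  obtain ⟨p, hp, hsub, hconc, hmono, hcash⟩ := exists_real_P hE hU_top hU_conc hA hcalls hc
    (u₀ := 0) (by rwa [hc0])
  have hm := hp 0
  rw [hc0] at hm
  obtain ⟨l', hl'⟩ := exists_linear_add_le_of_convexOn (G := -p) hconc.neg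
  obtain ⟨l, rfl⟩ : ∃ l, l' = -l := ⟨-l', (neg_neg l').symm⟩
  have hl : ∀ u, p u ≤ p 0 + l u := fun u => by
    have := hl' u
    simp only [Pi.neg_apply, LinearMap.neg_apply] at this
    linarith
  let emb : CSpace K → boundedSpace K := fun g => ⟨g.1, g.2.2⟩
  have hpos : ∀ u : boundedSpace K, (∀ x, 0 ≤ u.1 x) → 0 ≤ l u := fun u hu => by
    have h1 := hmono 0 u hu
    linarith [hl u]
  -- Cash additivity at `1` and at `-1` gives the two inequalities.
  have hone : l (constBd K 1) = 1 := by
    have h1 := hcash 0 1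
    have h2 := hcash 0 (-1)
    rw [zero_add] at h1 h2
    have h3 : constBd K (-1) = -constBd K 1 := rfl
    have h4 := hl (constBd K 1)
    have h5 := hl (constBd K (-1))
    rw [h3, map_neg] at h5
    rw [h3] at h2
    linarith
  have key : ∀ (g z : CSpace K) (φ : Hedge E) (v : ℝ), (∀ x, (g.1 x : EReal) ≤ c x) → -z ∈ A →
      (v : EReal) ≤ U φ → l (emb g) + v - l (emb φ.total) - l (emb z) ≤ p 0 := by
    intro g z φ v hg hz hv
    have h1 : v ≤ p (emb φ.total + emb z - emb g) := by
      refine hsub _ _ ⟨z, φ, 0, hz, fun x => ?_, by simpa using hv⟩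
      change ((φ.total.1 x + z.1 x - 0 : ℝ) : EReal)
        ≤ c x + ((φ.total.1 x + z.1 x - g.1 x : ℝ) : EReal)
      refine le_trans (le_of_eq ?_) (add_le_add_left (hg x) _)
      rw [← EReal.coe_add]
      congr 1
      ring
    have h2 := hl (emb φ.total + emb z - emb g)
    rw [map_sub, map_add] at h2
    linarith
  let g₀ : CSpace K := (-a) • ⟨weight, weight_mem_CSpace⟩
  have hA' : -(0 : CSpace K) ∈ A := by rwa [neg_zero]
  have hemb0 : l (emb 0) = 0 := map_zero l
  obtain ⟨Q, hQ, hQl⟩ := exists_measure_of_tight hK hpos hone fun ε hε => by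
    -- `key` with the hedge `-(Γ • F)` and value `-1` gives `Γ * l F ≤ p 0 - l g₀ + 1`, which is at
    -- most `Γ * ε`.
    let Γ : ℝ := (|p 0 - l (emb g₀)| + 1) / ε
    have hΓ : 0 < Γ := by positivity
    obtain ⟨F, R, hF0, hF, hU⟩ := hcalls.exists_dominating hΓ
    refine ⟨R, emb F.total, hF0, hF, ?_⟩
    have h1 := key g₀ 0 _ _ hc hA' hU
    rw [hemb0, Hedge.total_neg, Hedge.total_smul] at h1
    have h2 : l (emb (-(Γ • F.total))) = -(Γ * l (emb F.total)) := by
      rw [← smul_eq_mul, ← map_smul, ← map_neg]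
      rfl
    rw [h2] at h1
    have h3 : Γ * l (emb F.total) ≤ Γ * ε := by
      have : Γ * ε = |p 0 - l (emb g₀)| + 1 := div_mul_cancel₀ _ hε.ne'
      linarith [le_abs_self (p 0 - l (emb g₀))]
    exact le_of_mul_le_mul_left h3 hΓ
  have hint : ∀ g : CSpace K, ∫ x, g.1 x ∂Q = l (emb g) := fun g => (hQl g.1 g.2).2
  have hQ1 : Q ∈ Prob1 K := ⟨hQ, fun φ hφ => (hQl φ hφ).1⟩
  refine ⟨p 0, Q, hm, ⟨hQ1, fun z hz => ?_⟩, fun g φ v hg hv => ?_⟩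
  · rw [hint]
    by_contra! hlz
    lift U 0 to ℝ using ⟨hU_top 0, hU_zero⟩ with v hv
    -- If `l z > 0`, this multiple of `z` together with `φ = 0` violates `key`.
    let s : ℝ := (|p 0 - l (emb g₀) - v| + 1) / l (emb z)
    have hs : 0 < s := by positivity
    have h1 := key g₀ (-(s • z)) 0 v hc (by rw [neg_neg]; exact A.smul_mem hs hz) hv.le
    have h2 : l (emb (-(s • z))) = -(s * l (emb z)) := by
      rw [← smul_eq_mul, ← map_smul, ← map_neg]
      rfl
    have h3 : l (emb (0 : Hedge E).total) = 0 := by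
      rw [← hemb0]
      congr 2
      rw [← zero_smul ℝ (0 : Hedge E), Hedge.total_smul, zero_smul]
    have h4 : s * l (emb z) = |p 0 - l (emb g₀) - v| + 1 := div_mul_cancel₀ _ hlz.ne'
    rw [h2, h3, h4] at h1
    linarith [le_abs_self (p 0 - l (emb g₀) - v)]
  · rw [hint, pairing_eq_integral hQ1, hint]
    have := key g 0 φ v hg hA' hv
    linarith

/-- The measure works for all continuous minorants of `c` at once. `D U Q` is finite, by the
minorant `-a • weight` above and by `φ = 0` below, so it can be moved across the inequality before
`g` increases to `c`. -/
theorem exists_expect_add_D_le (hK : ∀ t j, IsClosed (K t j)) (hE : HasConstants E)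
    (hU_top : ∀ φ, U φ ≠ ⊤) (hU_conc : IsConcave U) (hU_zero : U 0 ≠ ⊥)
    (hA : (0 : CSpace K) ∈ A) (hcalls : CallsVanish U) {c : PathSpace K → EReal} {a : ℝ}
    (hlsc : LowerSemicontinuous c) (ha : 0 ≤ a)
    (hc : ∀ x, ((-a * weight x : ℝ) : EReal) ≤ c x) (hP : P hE U A c < ⊤) :
    ∃ Q ∈ Prob1Polar A, expect Q c + D U Q ≤ P hE U A c := by
  obtain ⟨m, Q, hm, hQ, hle⟩ := exists_measure_integral_add_le hK hE hU_top hU_conc hU_zero hA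
    hcalls hc hP
  refine ⟨Q, hQ, ?_⟩
  rw [hm]
  have hD : ∀ g : CSpace K, (∀ x, (g.1 x : EReal) ≤ c x) →
      D U Q ≤ ((m - ∫ x, g.1 x ∂Q : ℝ) : EReal) := fun g hg => iSup_le fun φ => by
    rcases eq_or_ne (U φ) ⊥ with hb | hb
    · rw [hb, EReal.bot_sub]
      exact bot_le
    · lift U φ to ℝ using ⟨hU_top _, hb⟩ with v hv
      rw [← EReal.coe_sub, EReal.coe_le_coe_iff]
      linarith [hle g φ v hg hv.le]
  let w : CSpace K := ⟨weight, weight_mem_CSpace⟩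
  have hDbot : D U Q ≠ ⊥ := by
    refine ne_bot_of_le_ne_bot ?_ (le_iSup (fun φ => U φ - (pairing φ Q : EReal)) 0)
    lift U 0 to ℝ using ⟨hU_top 0, hU_zero⟩ with v
    exact EReal.coe_ne_bot (v - pairing (0 : Hedge E) Q)
  lift D U Q to ℝ using ⟨((hD (-a • w) hc).trans_lt (EReal.coe_lt_top _)).ne, hDbot⟩ with δ
  have hadd : LowerSemicontinuous fun x => c x + ((a * weight x : ℝ) : EReal) := by
    refine hlsc.add' (continuous_coe_real_ereal.comp
      (continuous_const.mul continuous_weight)).lowerSemicontinuous fun x => ?_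
    exact EReal.continuousAt_add (Or.inr (EReal.coe_ne_bot _)) (Or.inr (EReal.coe_ne_top _))
  obtain ⟨g, hg, hgc, hgk, hgs⟩ := exists_continuous_monotone_iSup_eq
    (EReal.continuous_toENNReal.comp_lowerSemicontinuous hadd
      fun _ _ => EReal.toENNReal_le_toENNReal)
  have hgt : ∀ k x, g k x ≠ ⊤ := fun k x =>
    ne_top_of_le_ne_top (ENNReal.natCast_ne_top k) (hgk k x)
  have hgC : ∀ k, (fun x => (g k x).toReal) ∈ CSpace K := fun k => by
    refine ⟨continuous_iff_continuousAt.2 fun x =>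
      (ENNReal.tendsto_toReal (hgt k x)).comp (hgc k).continuousAt, k, fun x => ?_⟩
    rw [abs_of_nonneg ENNReal.toReal_nonneg]
    have h1 : (g k x).toReal ≤ k := by
      simpa using ENNReal.toReal_mono (ENNReal.natCast_ne_top k) (hgk k x)
    exact h1.trans (le_mul_of_one_le_right (Nat.cast_nonneg k) (one_le_weight x))
  have hexp : expect Q c ≤ ((m - δ : ℝ) : EReal) := by
    refine expect_le ha (hQ.1.2 _ w.2) weight_nonneg hlsc.measurable hc hg
      (fun k => (hgc k).measurable) hgt (fun k => hQ.1.2 _ (hgC k)) hgs fun k => ?_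
    have h := hD (⟨_, hgC k⟩ - a • w) fun x => ?_
    · rw [EReal.coe_le_coe_iff] at h
      change δ ≤ m - ∫ x, ((g k x).toReal - a * weight x) ∂Q at h
      linarith
    · change (((g k x).toReal - a * weight x : ℝ) : EReal) ≤ c x
      have h1 : g k x ≤ (c x + (a * weight x : ℝ)).toENNReal :=
        (le_iSup (fun k => g k x) k).trans_eq (hgs x)
      have h2 := hc x
      generalize c x = y at h1 h2 ⊢
      induction y with
      | bot => exact absurd (le_bot_iff.1 h2) (EReal.coe_ne_bot _)
      | top => exact le_top
      | coe y =>
        rw [EReal.coe_le_coe_iff] at h2 ⊢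
        rw [← EReal.coe_add, EReal.real_coe_toENNReal] at h1
        linarith [ENNReal.toReal_le_of_le_ofReal (by linarith) h1]
  refine (add_le_add_left hexp _).trans_eq ?_
  rw [← EReal.coe_add, sub_add_cancel]

end EMOT

end

theorem theorem2p1 {d T : ℕ} (hd : 1 ≤ d)
    (K : Fin (T + 1) → Fin d → Set ℝ) (hK : ∀ t j, IsClosed (K t j))
    (E : ∀ t, Submodule ℝ (EMOT.CSpace (EMOT.upTo K t))) (hE : EMOT.HasConstants E)
    (U : EMOT.Hedge E → EReal) (hU_top : ∀ φ, U φ ≠ ⊤) (hU_conc : EMOT.IsConcave U)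
    (hU_zero : U 0 ≠ ⊥)
    (A : ConvexCone ℝ (EMOT.CSpace K)) (hA : (0 : EMOT.CSpace K) ∈ A)
    (hcalls : EMOT.CallsVanish U) :
    -- part (i)
    ((∃ c₀ : EMOT.BSpace K, EMOT.P hE U A (fun x => (c₀.1 x : EReal)) < ⊤) →
      ∃ p : EMOT.BSpace K → ℝ,
        (∀ c : EMOT.BSpace K, EMOT.P hE U A (fun x => (c.1 x : EReal)) = (p c : EReal)) ∧
        (∀ (c : EMOT.BSpace K) (ε : ℝ), 0 < ε → ∃ δ : ℝ, 0 < δ ∧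
          ∀ c' : EMOT.BSpace K, EMOT.wNorm (c' - c).1 < δ → |p c' - p c| < ε) ∧
        (∀ (c : EMOT.BSpace K) (r : ℝ), p (c + EMOT.constB K r) = p c + r) ∧
        ConcaveOn ℝ Set.univ p ∧
        (∀ c c' : EMOT.BSpace K, (∀ x, c.1 x ≤ c'.1 x) → p c ≤ p c')) ∧
    -- part (ii)
    (∀ Q ∈ EMOT.Prob1 K,
      EMOT.D U Q = ⨆ φ : EMOT.Hedge E, (EMOT.pairing φ Q : EReal) - EMOT.V U φ) ∧
    (∀ c : EMOT.PathSpace K → EReal, LowerSemicontinuous c → (∀ x, c x ≠ ⊥) →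
      (∃ a : ℝ, 0 ≤ a ∧ ∀ x, ((-a * EMOT.weight x : ℝ) : EReal) ≤ c x) →
      EMOT.P hE U A c
          = ⨅ Q ∈ EMOT.Prob1Polar A, (EMOT.expect Q c + EMOT.D U Q) ∧
      (EMOT.P hE U A c < ⊤ →
        ∃ Q ∈ EMOT.Prob1Polar A, EMOT.expect Q c + EMOT.D U Q
          = ⨅ Q' ∈ EMOT.Prob1Polar A, (EMOT.expect Q' c + EMOT.D U Q'))) := by

  refine ⟨fun ⟨c₀, hc₀⟩ => ?_, fun Q _ => EMOT.D_eq_iSup_pairing_sub_V Q,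
    fun c hlsc _ ⟨a, ha, hc⟩ => ?_⟩
  · let ι : EMOT.BSpace K → EMOT.boundedSpace K := fun c => ⟨c.1, c.2.2⟩
    obtain ⟨p, hp, -, hconc, hmono, hcash⟩ := EMOT.exists_real_P (c := fun _ => 0) (a := 0)
      (u₀ := ι c₀) hE hU_top hU_conc hA hcalls (fun x => by simp) (by simpa [ι] using hc₀)
    refine ⟨fun c => p (ι c), fun c => by simpa [ι] using hp (ι c), fun c ε hε => ?_,
      fun c r => hcash (ι c) r, ⟨convex_univ, fun c _ c' _ s t hs ht hst => ?_⟩,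
      fun c c' h => hmono _ _ h⟩
    · obtain ⟨δ, hδ, h⟩ := EMOT.exists_wNorm_lt_of_concaveOn_of_mono hconc hmono (ι c) hε
      exact ⟨δ, hδ, fun c' hc' => h (ι c') hc'⟩
    · exact hconc.2 (Set.mem_univ (ι c)) (Set.mem_univ (ι c')) hs ht hst
  · have hle : EMOT.P hE U A c ≤ ⨅ Q ∈ EMOT.Prob1Polar A, (EMOT.expect Q c + EMOT.D U Q) :=
      le_iInf₂ fun Q hQ => EMOT.P_le_expect_add_D hE hU_top hQ
    -- If `P = ⊤`, weak duality alone forces the infimum to be `⊤`, even over an empty set of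
    -- measures.
    rcases eq_or_ne (EMOT.P hE U A c) ⊤ with htop | htop
    · rw [htop] at hle ⊢
      exact ⟨(top_le_iff.1 hle).symm, fun h => absurd h (lt_irrefl _)⟩
    · obtain ⟨Q, hQ, hQle⟩ := EMOT.exists_expect_add_D_le hK hE hU_top hU_conc hU_zero hA hcalls
        hlsc ha hc htop.lt_top
      have hinf : (⨅ Q ∈ EMOT.Prob1Polar A, (EMOT.expect Q c + EMOT.D U Q))
          ≤ EMOT.expect Q c + EMOT.D U Q := iInf₂_le Q hQ
      exact ⟨le_antisymm hle (hinf.trans hQle), fun _ =>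
        ⟨Q, hQ, le_antisymm (hQle.trans hle) hinf⟩⟩
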